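/- All graphs are finite and simple, and $\log$ denotes the logarithm to base $2$. For a graph $G$ on $n \ge 2$ vertices let $\lambda_1(G) \ge \lambda_2(G) \ge \dots \ge \lambda_n(G)$ be the eigenvalues of its adjacency matrix, listed with multiplicity, and let $m_G(\lambda)$ be the multiplicity of $\lambda$ as an eigenvalue of the adjacency matrix. Let $\Delta(G)$ be the maximum degree of $G$. Theorem 2.5. Let $G$ be a connected $n$-vertex graph with $\lambda_2 = \lambda_2(G) > 0$, and let $\Delta$ be a real number with $\Delta \ge \Delta(G) \ge 2$. Then $$m_G(\lambda_2) \le \begin{cases} \dfrac{4n \left(\log \log_{\Delta} n\right)^2}{\log_{\Delta} n} & \text{if } \lambda_2 \log \lambda_2 \ge \log_{\Delta} n > 2, \\[2ex] \dfrac{4n \log(\lambda_2+1)}{\lambda_2} & \text{if } \lambda_2 \log \lambda_2 \le \log_{\Delta} n. \end{cases}$$ -/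

import Mathlib

namespace SimpleGraph

/-- The real adjacency matrix of a finite graph is symmetric (Hermitian). -/
theorem adjMatrix_isHermitian {V : Type*} (G : SimpleGraph V) [DecidableRel G.Adj] :
    (G.adjMatrix ℝ).IsHermitian := by
  rw [Matrix.IsHermitian, Matrix.conjTranspose_eq_transpose_of_trivial]
  exact G.isSymm_adjMatrix

/-- The second largest eigenvalue `λ₂(G)` of the adjacency matrix, eigenvalues being listed with
multiplicity in decreasing order (`eigenvalues₀` is that list, indexed from `0`). The value is `0`
by convention for a graph with at most one vertex, which has no second eigenvalue. -/
noncomputable def secondEigenvalue {V : Type*} [Fintype V] [DecidableEq V] (G : SimpleGraph V)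
    [DecidableRel G.Adj] : ℝ :=
  if h : 1 < Fintype.card V then G.adjMatrix_isHermitian.eigenvalues₀ ⟨1, h⟩ else 0

/-- The multiplicity `m_G(μ)` of the real number `μ` as an eigenvalue of the (symmetric)
adjacency matrix of `G`: the dimension of its eigenspace. -/
noncomputable def eigenvalueMultiplicity {V : Type*} [Fintype V] [DecidableEq V]
    (G : SimpleGraph V) [DecidableRel G.Adj] (μ : ℝ) : ℕ :=
  Module.finrank ℝ (Module.End.eigenspace (Matrix.toLin' (G.adjMatrix ℝ)) μ)

end SimpleGraph

/-! Write μ = λ₂ and delete a small vertex set U ∪ X: the multiplicity drops by at most |U ∪ X|, and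
the rest times μ^(2s) is at most the number of closed walks of length 2s in what remains. X holds
the centres of radius-s balls on which the quadratic form exceeds μ. Two such balls must meet or be
joined by an edge, else a plane of test functions contradicts the choice of λ₂; so X lies in one
ball of radius 2s+1. Off X, a ball has operator norm at most μ, hence at most μ^(2s) closed walks at
its centre and degrees at most μ² inside. Walks visiting more than d vertices are mostly killed by a
greedy hitting set U; those visiting at most d vertices are few, because most of their steps revisit
old vertices. `Connected.eigenvalueMultiplicity_secondEigenvalue_mul_pow_le` combines these
estimates, and `Connected.eigenvalueMultiplicity_secondEigenvalue_le` chooses the parameters in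
terms of some ν ≤ μ. The two regimes take ν = L / log L, where L = log_Δ n, and ν = λ₂; small values
follow from m ≤ n. -/

open Matrix

/-! ### Spectral expansion of real symmetric matrices. -/

namespace Matrix.IsHermitian

variable {V : Type*} [Fintype V] [DecidableEq V] {A : Matrix V V ℝ}

/-- The vectors of the eigenvector basis of a real symmetric matrix, as plain functions. -/
noncomputable def eigenvec (hA : A.IsHermitian) (i : V) : V → ℝ := ⇑(hA.eigenvectorBasis i)

theorem mulVec_eigenvec (hA : A.IsHermitian) (i : V) :
    A *ᵥ hA.eigenvec i = hA.eigenvalues i • hA.eigenvec i :=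
  hA.mulVec_eigenvectorBasis i

theorem eq_sum_eigenvec (hA : A.IsHermitian) (f : V → ℝ) :
    f = ∑ i, (hA.eigenvec i ⬝ᵥ f) • hA.eigenvec i := by
  have h := congrArg WithLp.ofLp (hA.eigenvectorBasis.sum_repr' (WithLp.toLp 2 f))
  simp only [WithLp.ofLp_sum, WithLp.ofLp_smul, EuclideanSpace.inner_eq_star_dotProduct,
    star_trivial] at h
  conv_lhs => rw [← h]
  exact Finset.sum_congr rfl fun i _ => by rw [dotProduct_comm]; rfl

theorem dotProduct_self_eq_sum (hA : A.IsHermitian) (f : V → ℝ) :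
    f ⬝ᵥ f = ∑ i, (hA.eigenvec i ⬝ᵥ f) ^ 2 := by
  conv_lhs => enter [2]; rw [hA.eq_sum_eigenvec f]
  simp only [dotProduct_sum, dotProduct_smul, smul_eq_mul, sq]
  exact Finset.sum_congr rfl fun i _ => by rw [dotProduct_comm f]

theorem pow_mulVec_eigenvec (hA : A.IsHermitian) (k : ℕ) (i : V) :
    (A ^ k) *ᵥ hA.eigenvec i = hA.eigenvalues i ^ k • hA.eigenvec i := by
  induction k with
  | zero => simp
  | succ k ih =>
    rw [pow_succ, ← mulVec_mulVec, hA.mulVec_eigenvec, mulVec_smul, ih, smul_smul, pow_succ,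
      mul_comm]

theorem dotProduct_pow_mulVec_self_eq_sum (hA : A.IsHermitian) (k : ℕ) (f : V → ℝ) :
    f ⬝ᵥ (A ^ k) *ᵥ f = ∑ i, hA.eigenvalues i ^ k * (hA.eigenvec i ⬝ᵥ f) ^ 2 := by
  conv_lhs => enter [2, 2]; rw [hA.eq_sum_eigenvec f]
  simp only [mulVec_sum, mulVec_smul, hA.pow_mulVec_eigenvec, dotProduct_sum, dotProduct_smul,
    smul_eq_mul]
  exact Finset.sum_congr rfl fun i _ => by rw [dotProduct_comm f]; ring

theorem eigenvec_dotProduct_self (hA : A.IsHermitian) (i : V) :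
    hA.eigenvec i ⬝ᵥ hA.eigenvec i = 1 := by
  have h := hA.eigenvectorBasis.inner_eq_one i
  rwa [EuclideanSpace.inner_eq_star_dotProduct, star_trivial] at h

theorem trace_pow_eq_sum (hA : A.IsHermitian) (k : ℕ) :
    (A ^ k).trace = ∑ i, hA.eigenvalues i ^ k := by
  have h (v : V) : (A ^ k) v v = ∑ i, hA.eigenvalues i ^ k * hA.eigenvec i v ^ 2 := by
    have := hA.dotProduct_pow_mulVec_self_eq_sum k (Pi.single v 1)
    simpa using this
  simp only [trace, diag, h]
  rw [Finset.sum_comm]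
  refine Finset.sum_congr rfl fun i _ => ?_
  rw [← Finset.mul_sum]
  have := hA.eigenvec_dotProduct_self i
  simp only [dotProduct, ← sq] at this
  rw [this, mul_one]

theorem finrank_eigenspace_le_card (hA : A.IsHermitian) (μ : ℝ) :
    Module.finrank ℝ (Module.End.eigenspace (Matrix.toLin' A) μ) ≤
      (Finset.univ.filter fun i => hA.eigenvalues i = μ).card := by
  set S := Finset.univ.filter fun i => hA.eigenvalues i = μ
  let φ : (V → ℝ) →ₗ[ℝ] (S → ℝ) :=
    LinearMap.pi fun i => dotProductBilin ℝ ℝ (hA.eigenvec i)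
  have hφ (f : V → ℝ) (i : S) : φ f i = hA.eigenvec i ⬝ᵥ f := rfl
  have hinj : Function.Injective
      (φ.domRestrict (Module.End.eigenspace (Matrix.toLin' A) μ)) := by
    rw [← LinearMap.ker_eq_bot, LinearMap.ker_eq_bot']
    rintro ⟨f, hf⟩ h0
    rw [Module.End.mem_eigenspace_iff, toLin'_apply] at hf
    rw [Submodule.mk_eq_zero, hA.eq_sum_eigenvec f]
    refine Finset.sum_eq_zero fun i _ => ?_
    suffices hA.eigenvec i ⬝ᵥ f = 0 by rw [this, zero_smul]
    by_cases hi : hA.eigenvalues i = μ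
    · exact congrFun h0 ⟨i, by simpa [S] using hi⟩
    · have h1 : hA.eigenvec i ⬝ᵥ A *ᵥ f = hA.eigenvalues i * (hA.eigenvec i ⬝ᵥ f) := by
        rw [dotProduct_mulVec, ← mulVec_transpose, ← conjTranspose_eq_transpose_of_trivial, hA.eq,
          hA.mulVec_eigenvec, smul_dotProduct, smul_eq_mul]
      rw [hf, dotProduct_smul, smul_eq_mul] at h1
      have : (hA.eigenvalues i - μ) * (hA.eigenvec i ⬝ᵥ f) = 0 := by linarith
      exact (mul_eq_zero.1 this).resolve_left (sub_ne_zero.2 hi)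
  simpa using LinearMap.finrank_le_finrank_of_injective hinj

/-- Evenness of `k` makes the terms of all other eigenvalues nonnegative, so they can be dropped
from the trace. -/
theorem finrank_eigenspace_mul_pow_le_trace (hA : A.IsHermitian) (μ : ℝ) {k : ℕ} (hk : Even k) :
    Module.finrank ℝ (Module.End.eigenspace (Matrix.toLin' A) μ) * μ ^ k ≤ (A ^ k).trace := by
  rw [hA.trace_pow_eq_sum]
  calc _ ≤ ((Finset.univ.filter fun i => hA.eigenvalues i = μ).card : ℝ) * μ ^ k := by
        gcongr
        · exact hk.pow_nonneg _
        · exact hA.finrank_eigenspace_le_card μ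
    _ = ∑ i with hA.eigenvalues i = μ, hA.eigenvalues i ^ k := by
        rw [← nsmul_eq_mul, ← Finset.sum_const]
        exact Finset.sum_congr rfl fun i hi => by rw [(Finset.mem_filter.1 hi).2]
    _ ≤ _ := Finset.sum_le_sum_of_subset_of_nonneg (Finset.subset_univ _)
        fun i _ _ => hk.pow_nonneg _

/-- On a suitable hyperplane the quadratic form is bounded by the second eigenvalue. -/
theorem exists_forall_dotProduct_mulVec_le (hA : A.IsHermitian) (h : 1 < Fintype.card V) :
    ∃ u : V → ℝ, ∀ f, u ⬝ᵥ f = 0 → f ⬝ᵥ A *ᵥ f ≤ hA.eigenvalues₀ ⟨1, h⟩ * (f ⬝ᵥ f) := by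
  let e : Fin (Fintype.card V) ≃ V := Fintype.equivOfCardEq (Fintype.card_fin _)
  have h0 : 0 < Fintype.card V := by omega
  -- The hyperplane is orthogonal to a top eigenvector, which leaves only eigenvalues of index at
  -- least 1.
  refine ⟨hA.eigenvec (e ⟨0, h0⟩), fun f hf => ?_⟩
  have := hA.dotProduct_pow_mulVec_self_eq_sum 1 f
  simp only [pow_one] at this
  rw [this, hA.dotProduct_self_eq_sum f, Finset.mul_sum]
  refine Finset.sum_le_sum fun i _ => ?_
  obtain ⟨j, rfl⟩ := e.surjective i
  by_cases hj : j = ⟨0, h0⟩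
  · rw [hj, hf]; simp
  · refine mul_le_mul_of_nonneg_right ?_ (sq_nonneg _)
    have : hA.eigenvalues (e j) = hA.eigenvalues₀ j := by simp [eigenvalues, e]
    rw [this]
    apply hA.eigenvalues₀_antitone
    rw [Fin.le_def]
    have : j.val ≠ 0 := fun h => hj (Fin.ext h)
    show 1 ≤ j.val
    omega

end Matrix.IsHermitian

/-! ### Restricted graphs and their walks. -/

namespace SimpleGraph

variable {V : Type*}

/-- The spanning subgraph of `G` whose edges are those with both ends in `B`. -/
def restrictTo (G : SimpleGraph V) (B : Finset V) : SimpleGraph V where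
  Adj a b := G.Adj a b ∧ a ∈ B ∧ b ∈ B
  symm := ⟨fun _ _ h => ⟨h.1.symm, h.2.2, h.2.1⟩⟩
  loopless := ⟨fun _ h => G.irrefl h.1⟩

instance (G : SimpleGraph V) [DecidableEq V] [DecidableRel G.Adj] (B : Finset V) :
    DecidableRel (G.restrictTo B).Adj :=
  fun a b => inferInstanceAs (Decidable (G.Adj a b ∧ a ∈ B ∧ b ∈ B))

theorem restrictTo_adj {G : SimpleGraph V} {B : Finset V} {a b : V} :
    (G.restrictTo B).Adj a b ↔ G.Adj a b ∧ a ∈ B ∧ b ∈ B := Iff.rfl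

theorem restrictTo_le (G : SimpleGraph V) (B : Finset V) : G.restrictTo B ≤ G :=
  fun _ _ h => h.1

theorem Walk.support_subset_of_restrictTo {G : SimpleGraph V} {B : Finset V} {x y : V}
    (p : (G.restrictTo B).Walk x y) (hx : x ∈ B) : ∀ z ∈ p.support, z ∈ B := by
  induction p with
  | nil => simpa using hx
  | cons h p ih =>
    intro z hz
    rw [Walk.support_cons, List.mem_cons] at hz
    rcases hz with rfl | hz
    · exact hx
    · exact ih h.2.2 z hz

theorem Walk.exists_mapLe_restrictTo {G : SimpleGraph V} {B : Finset V} {x y : V}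
    (p : G.Walk x y) (hp : ∀ z ∈ p.support, z ∈ B) :
    ∃ q : (G.restrictTo B).Walk x y, q.mapLe (G.restrictTo_le B) = p := by
  induction p with
  | nil => exact ⟨.nil, rfl⟩
  | cons h p ih =>
    simp only [Walk.support_cons, List.mem_cons, forall_eq_or_imp] at hp
    obtain ⟨q, rfl⟩ := ih hp.2
    exact ⟨.cons ⟨h, hp.1, hp.2 _ (Walk.start_mem_support _)⟩ q, rfl⟩

/-- Cutting the closed walk at `x` leaves two arcs, one of length at most `s`. -/
theorem Walk.dist_le_of_mem_support {G : SimpleGraph V} [DecidableEq V] {s : ℕ} {v x : V}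
    (p : G.Walk v v) (hp : p.length = 2 * s) (hx : x ∈ p.support) : G.dist v x ≤ s := by
  have h := congrArg Walk.length (p.take_spec hx)
  rw [Walk.length_append] at h
  have h1 := dist_le (p.takeUntil x hx)
  have h2 := dist_le (p.dropUntil x hx)
  rw [dist_comm] at h2
  omega

/-- Prepending a fixed edge, as an embedding of walks. -/
def Walk.consEmbedding {G : SimpleGraph V} {x z : V} (h : G.Adj x z) (y : V) : G.Walk z y ↪ G.Walk x y :=
  ⟨Walk.cons h, fun p q hpq => by simpa using hpq⟩

theorem Walk.support_consEmbedding {G : SimpleGraph V} {x y z : V} (h : G.Adj x z) (p : G.Walk z y) :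
    (Walk.consEmbedding h y p).support = x :: p.support := rfl

/-! ### Balls and the adjacency quadratic form. -/

section Fintype

set_option linter.unusedSectionVars false

variable [Fintype V] [DecidableEq V] (G : SimpleGraph V) [DecidableRel G.Adj]

/-- The ball of radius `r` around `v` in the graph distance. -/
noncomputable def distBall (v : V) (r : ℕ) : Finset V := Finset.univ.filter fun w => G.dist v w ≤ r

variable {G}

theorem mem_distBall {v w : V} {r : ℕ} : w ∈ G.distBall v r ↔ G.dist v w ≤ r := by simp [distBall]

/-- The extra `+ 1` strengthens the induction: it turns the recursion b ↦ bD + 1 into a clean power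
once D ≥ 2. -/
theorem Connected.card_distBall_add_one_le (hG : G.Connected) {D : ℕ} (hD : G.maxDegree ≤ D)
    (hD2 : 2 ≤ D) (v : V) (r : ℕ) : (G.distBall v r).card + 1 ≤ D ^ (r + 1) := by
  induction r with
  | zero =>
    have : G.distBall v 0 ⊆ {v} := fun w hw => by
      rw [mem_distBall, Nat.le_zero, (hG v w).dist_eq_zero_iff] at hw
      simp [hw]
    have := Finset.card_le_card this
    simp only [Finset.card_singleton] at this
    simp only [zero_add, pow_one]
    omega
  | succ r ih =>
    have hsub : G.distBall v (r + 1) ⊆ insert v ((G.distBall v r).biUnion fun x => G.neighborFinset x) := by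
      intro w hw
      rw [mem_distBall] at hw
      obtain ⟨p, hp⟩ := (hG w v).exists_walk_length_eq_dist
      rw [dist_comm] at hp
      cases p with
      | nil => simp
      | @cons _ x _ h q =>
        rw [Walk.length_cons] at hp
        have := dist_le q
        rw [dist_comm] at this
        refine Finset.mem_insert_of_mem (Finset.mem_biUnion.2 ⟨x, mem_distBall.2 (by omega), ?_⟩)
        simpa using h.symm
    have h1 : (G.distBall v (r + 1)).card ≤ (G.distBall v r).card * D + 1 :=
      (Finset.card_le_card hsub).trans <| (Finset.card_insert_le _ _).trans <|
        Nat.add_le_add_right (Finset.card_biUnion_le_card_mul _ _ _ fun x _ => by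
          rw [card_neighborFinset_eq_degree]
          exact (G.degree_le_maxDegree x).trans hD) 1
    have h2 : ((G.distBall v r).card + 1) * D ≤ D ^ (r + 2) := by
      rw [pow_succ D (r + 1)]
      exact Nat.mul_le_mul_right D ih
    have : (G.distBall v r).card * D + D ≤ D ^ (r + 2) := by linarith
    show _ ≤ D ^ (r + 2)
    omega

variable (G) in
/-- The quadratic form of the adjacency matrix is at most `μ` times the square norm on functions
supported in `B`. -/
def FormBoundedOn (μ : ℝ) (B : Finset V) : Prop :=
  ∀ f : V → ℝ, (∀ x ∉ B, f x = 0) → f ⬝ᵥ G.adjMatrix ℝ *ᵥ f ≤ μ * (f ⬝ᵥ f)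

theorem dotProduct_adjMatrix_mulVec_eq_sum (f g : V → ℝ) :
    f ⬝ᵥ G.adjMatrix ℝ *ᵥ g = ∑ x, ∑ y, if G.Adj x y then f x * g y else 0 := by
  simp only [dotProduct, mulVec, adjMatrix_apply, Finset.mul_sum]
  refine Finset.sum_congr rfl fun x _ => Finset.sum_congr rfl fun y _ => ?_
  split_ifs <;> simp

theorem dotProduct_adjMatrix_mulVec_comm (f g : V → ℝ) :
    f ⬝ᵥ G.adjMatrix ℝ *ᵥ g = g ⬝ᵥ G.adjMatrix ℝ *ᵥ f := by
  rw [dotProduct_mulVec, ← mulVec_transpose, transpose_adjMatrix, dotProduct_comm]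

/-- Otherwise the violating functions on `B` and `C` have disjoint supports with no edge between
them, so all cross terms vanish; a nonzero combination orthogonal to `u` still violates the bound.
-/
theorem exists_near_of_not_formBoundedOn {μ : ℝ} {u : V → ℝ}
    (hu : ∀ f, u ⬝ᵥ f = 0 → f ⬝ᵥ G.adjMatrix ℝ *ᵥ f ≤ μ * (f ⬝ᵥ f)) {B C : Finset V}
    (hB : ¬ G.FormBoundedOn μ B) (hC : ¬ G.FormBoundedOn μ C) :
    ∃ x ∈ B, ∃ y ∈ C, x = y ∨ G.Adj x y := by
  by_contra! hcon
  simp only [FormBoundedOn, not_forall, not_le] at hB hC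
  obtain ⟨f, hf, hf'⟩ := hB
  obtain ⟨g, hg, hg'⟩ := hC
  have h1 : f ⬝ᵥ g = 0 := by
    refine Finset.sum_eq_zero fun x _ => ?_
    by_cases hx : x ∈ B
    · rw [hg x fun hx' => (hcon x hx x hx').1 rfl, mul_zero]
    · rw [hf x hx, zero_mul]
  have h2 : f ⬝ᵥ G.adjMatrix ℝ *ᵥ g = 0 := by
    rw [dotProduct_adjMatrix_mulVec_eq_sum]
    refine Finset.sum_eq_zero fun x _ => Finset.sum_eq_zero fun y _ => ?_
    split_ifs with hxy
    · by_cases hx : x ∈ B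
      · rw [hg y fun hy => (hcon x hx y hy).2 hxy, mul_zero]
      · rw [hf x hx, zero_mul]
    · rfl
  have h2' := h2
  rw [dotProduct_adjMatrix_mulVec_comm] at h2'
  have h1' := h1
  rw [dotProduct_comm] at h1'
  by_cases h0 : u ⬝ᵥ f = 0
  · exact absurd (hu f h0) (not_le.2 hf')
  have h3 := hu ((u ⬝ᵥ g) • f - (u ⬝ᵥ f) • g) (by
    rw [dotProduct_sub, dotProduct_smul, dotProduct_smul, smul_eq_mul, smul_eq_mul]; ring)
  simp only [mulVec_sub, mulVec_smul, dotProduct_sub, sub_dotProduct, dotProduct_smul,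
    smul_dotProduct, smul_eq_mul, h1, h2, h1', h2'] at h3
  have h4 : 0 < (u ⬝ᵥ f) ^ 2 := by positivity
  nlinarith [mul_lt_mul_of_pos_left hg' h4, mul_le_mul_of_nonneg_left hf'.le (sq_nonneg (u ⬝ᵥ g))]

/-- Truncating to `B` keeps the restricted form and does not increase the norm. -/
theorem formBoundedOn_univ_restrictTo {μ : ℝ} (hμ : 0 ≤ μ) {B : Finset V}
    (h : G.FormBoundedOn μ B) : (G.restrictTo B).FormBoundedOn μ Finset.univ := by
  intro f _
  have h1 := h (fun x => if x ∈ B then f x else 0) fun x hx => if_neg hx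
  have h2 : (f ⬝ᵥ (G.restrictTo B).adjMatrix ℝ *ᵥ f) =
      (fun x => if x ∈ B then f x else 0) ⬝ᵥ
        G.adjMatrix ℝ *ᵥ (fun x => if x ∈ B then f x else 0) := by
    simp only [dotProduct_adjMatrix_mulVec_eq_sum, restrictTo_adj]
    refine Finset.sum_congr rfl fun x _ => Finset.sum_congr rfl fun y _ => ?_
    by_cases hx : x ∈ B <;> by_cases hy : y ∈ B <;> simp [hx, hy]
  rw [h2]
  refine h1.trans (mul_le_mul_of_nonneg_left (Finset.sum_le_sum fun x _ => ?_) hμ)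
  beta_reduce
  split_ifs
  · rfl
  · simpa using mul_self_nonneg (f x)

/-- An upper bound for the quadratic form of an adjacency matrix bounds the operator norm. -/
theorem FormBoundedOn.mulVec_le {μ : ℝ} (hμ : 0 < μ) (h : G.FormBoundedOn μ Finset.univ)
    (f : V → ℝ) :
    (G.adjMatrix ℝ *ᵥ f) ⬝ᵥ (G.adjMatrix ℝ *ᵥ f) ≤ μ ^ 2 * (f ⬝ᵥ f) := by
  have hup (f : V → ℝ) : f ⬝ᵥ G.adjMatrix ℝ *ᵥ f ≤ μ * (f ⬝ᵥ f) := h f (by simp)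
  -- Nonnegative entries: replacing `f` by |f| gives the lower bound from the upper one.
  have hlow (f : V → ℝ) : -(μ * (f ⬝ᵥ f)) ≤ f ⬝ᵥ G.adjMatrix ℝ *ᵥ f := by
    have h1 := hup fun x => |f x|
    have h2 : (fun x => |f x|) ⬝ᵥ (fun x => |f x|) = f ⬝ᵥ f :=
      Finset.sum_congr rfl fun x _ => abs_mul_abs_self _
    have h3 : -((fun x => |f x|) ⬝ᵥ G.adjMatrix ℝ *ᵥ (fun x => |f x|)) ≤
        f ⬝ᵥ G.adjMatrix ℝ *ᵥ f := by
      simp only [dotProduct_adjMatrix_mulVec_eq_sum, ← Finset.sum_neg_distrib]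
      refine Finset.sum_le_sum fun x _ => Finset.sum_le_sum fun y _ => ?_
      split_ifs
      · rw [← abs_mul]; exact neg_abs_le _
      · simp
    rw [h2] at h1
    linarith
  set g := G.adjMatrix ℝ *ᵥ f with hg
  -- On subtracting the two bounds, the terms g·Ag and f·g cancel, leaving |g|² ≤ μ²|f|².
  have h1 := hup (μ • f + g)
  have h2 := hlow (μ • f - g)
  have h3 : f ⬝ᵥ G.adjMatrix ℝ *ᵥ g = g ⬝ᵥ g := by rw [dotProduct_adjMatrix_mulVec_comm, ← hg]
  simp only [mulVec_add, mulVec_sub, mulVec_smul, dotProduct_add, dotProduct_sub, add_dotProduct,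
    sub_dotProduct, dotProduct_smul, smul_dotProduct, smul_eq_mul, ← hg, h3,
    dotProduct_comm g f] at h1 h2
  have : μ * (g ⬝ᵥ g) ≤ μ * (μ ^ 2 * (f ⬝ᵥ f)) := by nlinarith
  exact le_of_mul_le_mul_left this hμ

/-- The degree is the squared norm of the column of the adjacency matrix at `x`. -/
theorem FormBoundedOn.degree_le {μ : ℝ} (hμ : 0 < μ) (h : G.FormBoundedOn μ Finset.univ)
    (x : V) : (G.degree x : ℝ) ≤ μ ^ 2 := by
  have := h.mulVec_le hμ (Pi.single x 1)
  simp only [mulVec_single_one, single_one_dotProduct, Pi.single_eq_same, mul_one] at this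
  refine le_trans (le_of_eq ?_) this
  rw [← card_neighborFinset_eq_degree, neighborFinset_eq_filter, Finset.card_filter]
  push_cast
  refine Finset.sum_congr rfl fun y _ => ?_
  simp only [Matrix.col_apply, adjMatrix_apply, G.adj_comm y x]
  split_ifs <;> simp

/-- By symmetry the diagonal entry is |A^s e_v|², and each factor A costs at most μ in norm. -/
theorem FormBoundedOn.pow_apply_self_le {μ : ℝ} (hμ : 0 < μ)
    (h : G.FormBoundedOn μ Finset.univ) (s : ℕ) (v : V) :
    (G.adjMatrix ℝ ^ (2 * s)) v v ≤ μ ^ (2 * s) := by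
  have key (s : ℕ) : (G.adjMatrix ℝ ^ s *ᵥ Pi.single v 1) ⬝ᵥ
      (G.adjMatrix ℝ ^ s *ᵥ Pi.single v 1) ≤ μ ^ (2 * s) := by
    induction s with
    | zero => simp [dotProduct, Matrix.one_apply]
    | succ s ih =>
      rw [pow_succ', ← mulVec_mulVec]
      refine (h.mulVec_le hμ _).trans ?_
      calc _ ≤ μ ^ 2 * μ ^ (2 * s) := by gcongr
        _ = _ := by ring
  refine le_trans (le_of_eq ?_) (key s)
  rw [two_mul, pow_add, dotProduct_mulVec, ← mulVec_transpose, transpose_pow, transpose_adjMatrix,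
    mulVec_mulVec]
  simp

theorem pow_adjMatrix_apply_eq_card (k : ℕ) (u v : V) :
    (G.adjMatrix ℝ ^ k) u v = (G.finsetWalkLength k u v).card := by
  rw [adjMatrix_pow_apply_eq_card_walk, card_set_walk_length_eq]

end Fintype

end SimpleGraph

/-! ### Greedy hitting sets. -/

/-- Greedy hitting sets: if each member of a family of sets has at least `k` elements, then some
`t` points hit all but a fraction `exp (-k t / n)` of the family. -/
theorem Finset.exists_hitting_set {ι V : Type*} [Fintype V] [DecidableEq V]
    (F : Finset ι) (S : ι → Finset V) (k : ℕ) (hS : ∀ i ∈ F, k ≤ (S i).card) (t : ℕ) :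
    ∃ U : Finset V, U.card ≤ t ∧ ((F.filter fun i => Disjoint (S i) U).card : ℝ) ≤
      F.card * Real.exp (-(k * t / Fintype.card V)) := by
  classical
  induction t with
  | zero => exact ⟨∅, by simp, by simp⟩
  | succ t ih =>
    obtain ⟨U, hU, hFU⟩ := ih
    set F' := F.filter fun i => Disjoint (S i) U with hF'
    set n := Fintype.card V with hn
    obtain hV | hV := isEmpty_or_nonempty V
    · exact ⟨U, hU.trans (Nat.le_succ t), by simp [hn]⟩
    have hn0 : (0 : ℝ) < n := by exact_mod_cast Fintype.card_pos
    -- Averaging over vertices: some `u` hits a fraction at least k/n of the sets not yet hit.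
    obtain ⟨u, -, hu⟩ : ∃ u ∈ (Finset.univ : Finset V),
        (k * F'.card : ℝ) / n ≤ ((F'.filter fun i => u ∈ S i).card : ℝ) := by
      apply Finset.exists_le_of_sum_le Finset.univ_nonempty
      rw [Finset.sum_const, Finset.card_univ, nsmul_eq_mul, ← hn, mul_div_cancel₀ _ hn0.ne']
      have h1 : ∑ u, (F'.filter fun i => u ∈ S i).card = ∑ i ∈ F', (S i).card := by
        simp only [Finset.card_filter]
        rw [Finset.sum_comm]
        simp
      have h2 : F'.card * k ≤ ∑ i ∈ F', (S i).card := by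
        rw [← smul_eq_mul, ← Finset.sum_const]
        exact Finset.sum_le_sum fun i hi => hS i (Finset.mem_filter.1 hi).1
      rw [← h1] at h2
      have h3 : ((F'.card * k : ℕ) : ℝ) ≤ ((∑ u, (F'.filter fun i => u ∈ S i).card : ℕ) : ℝ) := by
        exact_mod_cast h2
      push_cast at h3
      linarith
    refine ⟨insert u U, (Finset.card_insert_le _ _).trans (Nat.succ_le_succ hU), ?_⟩
    have h1 : (F.filter fun i => Disjoint (S i) (insert u U)) = F'.filter fun i => u ∉ S i := by
      ext i
      simp only [hF', Finset.mem_filter, Finset.disjoint_insert_right]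
      tauto
    have h2 := Finset.card_filter_add_card_filter_not (s := F') (fun i => u ∈ S i)
    have h3 : ((F'.filter fun i => u ∈ S i).card : ℝ) + (F'.filter fun i => u ∉ S i).card =
      F'.card := by exact_mod_cast h2
    rw [h1]
    calc ((F'.filter fun i => u ∉ S i).card : ℝ) ≤ F'.card * (-(k / n) + 1) := by
          have : (k * F'.card : ℝ) / n = F'.card * (k / n) := by ring
          linarith
      _ ≤ F'.card * Real.exp (-(k / n)) := by gcongr; exact Real.add_one_le_exp _
      _ ≤ F.card * Real.exp (-(k * t / n)) * Real.exp (-(k / n)) := by gcongr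
      _ = F.card * Real.exp (-(k * (t + 1 : ℕ) / n)) := by
          rw [mul_assoc, ← Real.exp_add]
          congr 2
          push_cast
          ring

/-! ### Walks with small support, and deletion of vertices. -/

namespace SimpleGraph

variable {V : Type*} [Fintype V] [DecidableEq V] {G : SimpleGraph V} [DecidableRel G.Adj]

theorem finsetWalkLength_succ (l : ℕ) (x y : V) : G.finsetWalkLength (l + 1) x y =
    Finset.univ.biUnion fun z : G.neighborSet x =>
      (G.finsetWalkLength l z y).map (Walk.consEmbedding ((G.mem_neighborSet x z).1 z.2) y) := rfl

/-- In a graph of maximum degree at most `Q`, few walks visit at most `d` distinct vertices. -/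
theorem card_walks_small_support_le {Q w : ℝ} (hQ : ∀ x, (G.degree x : ℝ) ≤ Q) (hQ0 : 0 ≤ Q)
    (hw : 1 ≤ w) (d l : ℕ) (x y : V) (S : Finset V) (hx : x ∈ S) (hS : S.card ≤ d) :
    (((G.finsetWalkLength l x y).filter fun p => (S ∪ p.support.toFinset).card ≤ d).card : ℝ) ≤
      (d + Q / w) ^ l * w ^ (d - S.card) := by
  have hw0 : 0 < w := by linarith
  induction l generalizing x S with
  | zero =>
    have h1 : (G.finsetWalkLength 0 x y).card ≤ 1 := by
      unfold finsetWalkLength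
      split_ifs with h
      · subst h; simp
      · simp
    have h2 := (Finset.card_filter_le (G.finsetWalkLength 0 x y)
      fun p => (S ∪ p.support.toFinset).card ≤ d).trans h1
    calc _ ≤ (1 : ℝ) := by exact_mod_cast h2
      _ ≤ _ := by rw [pow_zero, one_mul]; exact one_le_pow₀ hw
  | succ l ih =>
    set M := (d + Q / w) ^ l * w ^ (d - S.card) with hM
    have hM0 : 0 ≤ M := by positivity
    -- `S` is the set visited so far. A step inside `S` has at most `d` choices; a step to a new
    -- vertex has at most `Q` choices and uses up one factor `w`. This gives the base d + Q/w.
    have key (z : G.neighborSet x) :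
        ((((G.finsetWalkLength l z y).map
          (Walk.consEmbedding ((G.mem_neighborSet x z).1 z.2) y)).filter
            fun p => (S ∪ p.support.toFinset).card ≤ d).card : ℝ) ≤
          (if (z : V) ∈ S then M else 0) + M / w := by
      rw [Finset.filter_map, Finset.card_map]
      have hunion (p : G.Walk z y) : S ∪ (Walk.consEmbedding ((G.mem_neighborSet x z).1 z.2) y p).support.toFinset =
          insert (z : V) S ∪ p.support.toFinset := by
        have := p.start_mem_support
        rw [Walk.support_consEmbedding]
        ext a
        simp only [List.toFinset_cons, Finset.mem_union, Finset.mem_insert,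
          List.mem_toFinset]
        constructor
        · rintro (h | h | h)
          · tauto
          · exact Or.inl (Or.inr (h ▸ hx))
          · tauto
        · rintro ((h | h) | h)
          · exact Or.inr (Or.inr (h ▸ this))
          · tauto
          · tauto
      simp only [Function.comp_def, hunion]
      by_cases hz : (z : V) ∈ S
      · rw [if_pos hz, Finset.insert_eq_of_mem hz]
        have := ih z S hz hS
        have : 0 ≤ M / w := by positivity
        linarith
      · rw [if_neg hz, zero_add]
        have hc := Finset.card_insert_of_notMem hz
        by_cases hd : S.card + 1 ≤ d
        · refine (ih z (insert (z : V) S) (Finset.mem_insert_self _ _) (by omega)).trans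
            (le_of_eq ?_)
          rw [hc, hM, show d - S.card = d - (S.card + 1) + 1 by omega, pow_succ]
          field_simp
        · rw [Finset.filter_false_of_mem]
          · simp only [Finset.card_empty, Nat.cast_zero]; positivity
          · intro p _ hp
            have := (Finset.card_le_card (Finset.subset_union_left
              (s₁ := insert (z : V) S) (s₂ := p.support.toFinset))).trans hp
            omega
    rw [finsetWalkLength_succ, Finset.filter_biUnion]
    have h1 : (((Finset.univ : Finset (G.neighborSet x)).biUnion fun z =>
        ((G.finsetWalkLength l z y).map
          (Walk.consEmbedding ((G.mem_neighborSet x z).1 z.2) y)).filter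
            fun p => (S ∪ p.support.toFinset).card ≤ d).card : ℝ) ≤
        ∑ z : G.neighborSet x, ((if (z : V) ∈ S then M else 0) + M / w) :=
      le_trans (by exact_mod_cast Finset.card_biUnion_le) (Finset.sum_le_sum fun z _ => key z)
    refine h1.trans ?_
    rw [Finset.sum_add_distrib, Finset.sum_const, Finset.card_univ, card_neighborSet_eq_degree,
      nsmul_eq_mul, ← Finset.sum_filter, Finset.sum_const, nsmul_eq_mul]
    have h2 : (Finset.univ.filter fun z : G.neighborSet x => (z : V) ∈ S).card ≤ d := by
      refine le_trans ?_ hS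
      exact Finset.card_le_card_of_injOn (fun z => (z : V))
        (fun z hz => (Finset.mem_filter.1 hz).2) (fun a _ b _ h => Subtype.ext h)
    calc _ ≤ (d : ℝ) * M + Q * (M / w) := by
          gcongr
          exact hQ x
      _ = _ := by rw [hM]; ring

/-- Passing to the restriction to the complement of `W` lowers an eigenvalue multiplicity by at
most the cardinality of `W`. -/
theorem eigenvalueMultiplicity_le_card_add (W : Finset V) (μ : ℝ) :
    G.eigenvalueMultiplicity μ ≤ W.card + (G.restrictTo Wᶜ).eigenvalueMultiplicity μ := by
  unfold eigenvalueMultiplicity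
  set E := Module.End.eigenspace (toLin' (G.adjMatrix ℝ)) μ
  -- Eigenvectors vanishing on `W`, the kernel of `φ`, remain eigenvectors after the deletion.
  let φ : E →ₗ[ℝ] (W → ℝ) := LinearMap.funLeft ℝ ℝ (Subtype.val : W → V) ∘ₗ E.subtype
  rw [← LinearMap.finrank_range_add_finrank_ker φ]
  refine add_le_add ((Submodule.finrank_le _).trans (by simp)) ?_
  rw [← Submodule.finrank_map_subtype_eq E (LinearMap.ker φ)]
  refine Submodule.finrank_mono ?_
  rintro _ ⟨⟨f, hf⟩, h0, rfl⟩
  have h0 (x : V) (hx : x ∈ W) : f x = 0 := congrFun (LinearMap.mem_ker.1 h0) ⟨x, hx⟩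
  rw [Submodule.subtype_apply, Module.End.mem_eigenspace_iff, toLin'_apply]
  rw [Module.End.mem_eigenspace_iff, toLin'_apply] at hf
  funext x
  have hx := congrFun hf x
  rw [adjMatrix_mulVec_apply] at hx ⊢
  by_cases hxW : x ∈ W
  · simp only [Pi.smul_apply, h0 x hxW, smul_zero]
    refine Finset.sum_eq_zero fun y hy => ?_
    rw [mem_neighborFinset] at hy
    exact absurd hxW (Finset.mem_compl.1 hy.2.1)
  · refine Eq.trans ?_ hx
    refine Finset.sum_subset (fun y hy => ?_) fun y hy hy' => ?_
    · rw [mem_neighborFinset] at hy ⊢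
      exact hy.1
    · rw [mem_neighborFinset] at hy hy'
      refine h0 y (by_contra fun hyW => hy' ⟨hy, ?_, ?_⟩) <;> simpa

theorem eigenvalueMultiplicity_mul_pow_le_sum (μ : ℝ) {k : ℕ} (hk : Even k) :
    G.eigenvalueMultiplicity μ * μ ^ k ≤ ∑ v, ((G.finsetWalkLength k v v).card : ℝ) := by
  refine (G.adjMatrix_isHermitian.finrank_eigenspace_mul_pow_le_trace μ hk).trans (le_of_eq ?_)
  simp only [trace, diag, pow_adjMatrix_apply_eq_card]

end SimpleGraph

/-! ### Closed walks in balls and the combined estimate. -/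

namespace SimpleGraph

variable {V : Type*} [Fintype V] [DecidableEq V] {G : SimpleGraph V} [DecidableRel G.Adj]

/-- A closed walk of length `2 * s` stays in the ball of radius `s`, so that such walks may be
counted in the restriction of the graph to that ball. -/
theorem card_closed_walks_le_restrictTo (v : V) (s : ℕ) (P : Finset V → Prop) [DecidablePred P] :
    ((G.finsetWalkLength (2 * s) v v).filter fun p => P p.support.toFinset).card ≤
      (((G.restrictTo (G.distBall v s)).finsetWalkLength (2 * s) v v).filter
        fun p => P p.support.toFinset).card := by
  refine (Finset.card_le_card (t := (((G.restrictTo (G.distBall v s)).finsetWalkLength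
    (2 * s) v v).filter fun p => P p.support.toFinset).image
      (Walk.mapLe (G.restrictTo_le _))) fun p hp => ?_).trans Finset.card_image_le
  rw [Finset.mem_filter, mem_finsetWalkLength_iff] at hp
  obtain ⟨q, rfl⟩ := p.exists_mapLe_restrictTo (B := G.distBall v s)
    fun z hz => mem_distBall.2 (p.dist_le_of_mem_support hp.1 hz)
  rw [Walk.length_mapLe, Walk.support_mapLe_eq_support] at hp
  exact Finset.mem_image_of_mem _ (Finset.mem_filter.2 ⟨mem_finsetWalkLength_iff.2 hp.1, hp.2⟩)

theorem FormBoundedOn.card_closed_walks_le {μ : ℝ} (hμ : 0 < μ) {v : V} {s : ℕ}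
    (h : G.FormBoundedOn μ (G.distBall v s)) :
    ((G.finsetWalkLength (2 * s) v v).card : ℝ) ≤ μ ^ (2 * s) := by
  have h1 := card_closed_walks_le_restrictTo (G := G) v s fun _ => True
  simp only [Finset.filter_true] at h1
  refine (Nat.cast_le (α := ℝ).2 h1).trans ?_
  rw [← pow_adjMatrix_apply_eq_card]
  exact (formBoundedOn_univ_restrictTo hμ.le h).pow_apply_self_le hμ s v

theorem FormBoundedOn.card_closed_walks_small_support_le {μ : ℝ} (hμ : 0 < μ) {v : V} {s : ℕ}
    (h : G.FormBoundedOn μ (G.distBall v s)) {d : ℕ} (hd : 1 ≤ d) {w : ℝ} (hw : 1 ≤ w) :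
    (((G.finsetWalkLength (2 * s) v v).filter fun p => p.support.toFinset.card ≤ d).card : ℝ) ≤
      (d + μ ^ 2 / w) ^ (2 * s) * w ^ d := by
  have h1 := card_closed_walks_le_restrictTo (G := G) v s fun S => S.card ≤ d
  have h2 := card_walks_small_support_le
    (fun x => (formBoundedOn_univ_restrictTo hμ.le h).degree_le hμ x) (sq_nonneg μ) hw d (2 * s) v v
    {v} (Finset.mem_singleton_self v) (by simpa using hd)
  have h3 (p : (G.restrictTo (G.distBall v s)).Walk v v) :
      {v} ∪ p.support.toFinset = p.support.toFinset :=
    Finset.union_eq_right.2 (by simp)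
  simp only [h3] at h2
  refine le_trans (by exact_mod_cast h1) (h2.trans ?_)
  have hw0 : 0 < w := by linarith
  gcongr
  omega

/-- Centres of balls on which the quadratic form exceeds the second eigenvalue are close to each
other, and therefore few. -/
theorem Connected.card_not_formBoundedOn_le (hG : G.Connected) (hpos : 0 < G.secondEigenvalue)
    {D : ℕ} (hD : G.maxDegree ≤ D) (hD2 : 2 ≤ D) (s : ℕ) (X : Finset V)
    (hX : ∀ v ∈ X, ¬ G.FormBoundedOn G.secondEigenvalue (G.distBall v s)) :
    X.card ≤ D ^ (2 * s + 2) := by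
  have hV : 1 < Fintype.card V := by
    by_contra h
    rw [secondEigenvalue, dif_neg h] at hpos
    exact hpos.false
  have hlam : G.secondEigenvalue = G.adjMatrix_isHermitian.eigenvalues₀ ⟨1, hV⟩ := dif_pos hV
  obtain ⟨u, hu⟩ := G.adjMatrix_isHermitian.exists_forall_dotProduct_mulVec_le hV
  rw [← hlam] at hu
  obtain rfl | ⟨v, hv⟩ := X.eq_empty_or_nonempty
  · simp
  refine (Finset.card_le_card (t := G.distBall v (2 * s + 1)) fun z hz => ?_).trans
    ((Nat.le_succ _).trans (hG.card_distBall_add_one_le hD hD2 v (2 * s + 1)))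
  obtain ⟨x, hx, y, hy, hxy⟩ := exists_near_of_not_formBoundedOn hu (hX v hv) (hX z hz)
  rw [mem_distBall] at hx hy ⊢
  have h1 := hG.dist_triangle (u := v) (v := x) (w := z)
  have h2 := hG.dist_triangle (u := x) (v := y) (w := z)
  rw [dist_comm (u := y)] at h2
  have h3 : G.dist x y ≤ 1 := by
    rcases hxy with rfl | h
    · simp
    · exact (dist_eq_one_iff_adj.2 h).le
  omega

/-- Closed walks of positive length in the restriction of `G` to the complement of `W`. -/
theorem card_closed_walks_restrictTo_compl_le (W : Finset V) {k : ℕ} (hk : 1 ≤ k) (v : V) :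
    ((G.restrictTo Wᶜ).finsetWalkLength k v v).card ≤
      if v ∈ W then 0 else
        ((G.finsetWalkLength k v v).filter fun p => Disjoint p.support.toFinset W).card := by
  split_ifs with hv
  · rw [Nat.le_zero, Finset.card_eq_zero, Finset.eq_empty_iff_forall_notMem]
    intro p hp
    rw [mem_finsetWalkLength_iff] at hp
    -- Vertices of `W` survive as isolated vertices, so only the trivial walk starts there; `hk`
    -- excludes it.
    cases p with
    | nil => simp at hp; omega
    | cons h p => exact Finset.mem_compl.1 h.2.1 hv
  · refine Finset.card_le_card_of_injOn (Walk.mapLe (G.restrictTo_le _)) (fun p hp => ?_)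
      (Walk.map_injective_of_injective (fun _ _ h => h) v v).injOn
    rw [Finset.mem_coe, mem_finsetWalkLength_iff] at hp
    rw [Finset.mem_coe, Finset.mem_filter, mem_finsetWalkLength_iff, Walk.length_mapLe,
      Walk.support_mapLe_eq_support, Finset.disjoint_left]
    exact ⟨hp, fun z hz => Finset.mem_compl.1
      (p.support_subset_of_restrictTo (Finset.mem_compl.2 hv) z (List.mem_toFinset.1 hz))⟩

/-- The three terms account for the deleted vertices, the walks with large support missed by the
hitting set, and the walks with small support. The parameters `s`, `d`, `t`, `w` stay free for later
optimisation. -/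
theorem Connected.eigenvalueMultiplicity_secondEigenvalue_mul_pow_le (hG : G.Connected) {μ : ℝ}
    (hμ : μ = G.secondEigenvalue) (hpos : 0 < μ) {D : ℕ} (hD : G.maxDegree ≤ D) (hD2 : 2 ≤ D)
    {s d : ℕ} (hs : 1 ≤ s) (hd : 1 ≤ d) (t : ℕ) {w : ℝ} (hw : 1 ≤ w) :
    G.eigenvalueMultiplicity μ * μ ^ (2 * s) ≤
      (t + D ^ (2 * s + 2)) * μ ^ (2 * s) +
      Fintype.card V * μ ^ (2 * s) * Real.exp (-((d + 1) * t / Fintype.card V)) +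
      Fintype.card V * ((d + μ ^ 2 / w) ^ (2 * s) * w ^ d) := by
  classical
  set X : Finset V := Finset.univ.filter fun v => ¬ G.FormBoundedOn μ (G.distBall v s) with hXdef
  have hX (v : V) (hv : v ∈ Xᶜ) : G.FormBoundedOn μ (G.distBall v s) := by
    simpa [hXdef] using hv
  have hXcard : X.card ≤ D ^ (2 * s + 2) :=
    hG.card_not_formBoundedOn_le (hμ ▸ hpos) hD hD2 s X fun v hv => by
      rw [← hμ]; exact (Finset.mem_filter.1 hv).2
  have hcompl : (Xᶜ.card : ℝ) ≤ Fintype.card V := by exact_mod_cast Finset.card_le_univ _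
  let F : Finset (Σ v, G.Walk v v) := Xᶜ.sigma fun v =>
    (G.finsetWalkLength (2 * s) v v).filter fun p => d + 1 ≤ p.support.toFinset.card
  obtain ⟨U, hU, hFU⟩ := F.exists_hitting_set (fun p => p.2.support.toFinset) (d + 1)
    (fun p hp => (Finset.mem_filter.1 (Finset.mem_sigma.1 hp).2).2) t
  have hF : (F.card : ℝ) ≤ Fintype.card V * μ ^ (2 * s) := by
    rw [Finset.card_sigma]
    push_cast
    calc _ ≤ ∑ v ∈ Xᶜ, μ ^ (2 * s) := Finset.sum_le_sum fun v hv =>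
          le_trans (by exact_mod_cast Finset.card_filter_le _ _)
            ((hX v hv).card_closed_walks_le hpos)
      _ ≤ _ := by rw [Finset.sum_const, nsmul_eq_mul]; gcongr
  have hmul : (G.eigenvalueMultiplicity μ : ℝ) ≤ (t + D ^ (2 * s + 2)) +
      (G.restrictTo (U ∪ X)ᶜ).eigenvalueMultiplicity μ := by
    have h1 := eigenvalueMultiplicity_le_card_add (G := G) (U ∪ X) μ
    have h2 : (U ∪ X).card ≤ t + D ^ (2 * s + 2) :=
      (Finset.card_union_le _ _).trans (add_le_add hU hXcard)
    exact_mod_cast h1.trans (Nat.add_le_add_right h2 _)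
  have hsplit (v : V) : ((G.restrictTo (U ∪ X)ᶜ).finsetWalkLength (2 * s) v v).card ≤
      if v ∈ X then 0 else
        ((G.finsetWalkLength (2 * s) v v).filter fun p => d + 1 ≤ p.support.toFinset.card ∧
          Disjoint p.support.toFinset U).card +
        ((G.finsetWalkLength (2 * s) v v).filter fun p => p.support.toFinset.card ≤ d).card := by
    refine (card_closed_walks_restrictTo_compl_le (U ∪ X) (by omega) v).trans ?_
    by_cases hv : v ∈ X
    · simp [hv]
    · rw [if_neg hv]
      split_ifs
      · exact Nat.zero_le _
      refine (Finset.card_le_card fun p hp => ?_).trans (Finset.card_union_le _ _)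
      simp only [Finset.mem_union, Finset.mem_filter, Finset.disjoint_union_right] at hp ⊢
      rcases Nat.lt_or_ge d p.support.toFinset.card with h | h
      · exact Or.inl ⟨hp.1, h, hp.2.1⟩
      · exact Or.inr ⟨hp.1, h⟩
  have hsum : ∑ v, (((G.restrictTo (U ∪ X)ᶜ).finsetWalkLength (2 * s) v v).card : ℝ) ≤
      Fintype.card V * μ ^ (2 * s) * Real.exp (-((d + 1) * t / Fintype.card V)) +
      Fintype.card V * ((d + μ ^ 2 / w) ^ (2 * s) * w ^ d) := by
    have h1 := Finset.sum_le_sum fun v (_ : v ∈ (Finset.univ : Finset V)) => hsplit v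
    have h2 (b : V → ℕ) : ∑ v, (if v ∈ X then 0 else b v) = ∑ v ∈ Xᶜ, b v := by
      rw [← Finset.sum_subset (Finset.subset_univ Xᶜ)]
      · exact Finset.sum_congr rfl fun v hv => if_neg (Finset.mem_compl.1 hv)
      · intro v _ hv
        exact if_pos (by simpa using hv)
    rw [h2, Finset.sum_add_distrib] at h1
    have h1 := Nat.cast_le (α := ℝ).2 h1
    rw [← Finset.card_sigma Xᶜ fun v => (G.finsetWalkLength (2 * s) v v).filter fun p =>
      d + 1 ≤ p.support.toFinset.card ∧ Disjoint p.support.toFinset U] at h1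
    push_cast at h1
    refine h1.trans ?_
    refine add_le_add ?_ ?_
    · have h3 : (Xᶜ.sigma fun v => (G.finsetWalkLength (2 * s) v v).filter fun p =>
          d + 1 ≤ p.support.toFinset.card ∧ Disjoint p.support.toFinset U) ⊆
          F.filter fun p => Disjoint p.2.support.toFinset U := by
        intro p hp
        simp only [F, Finset.mem_sigma, Finset.mem_filter] at hp ⊢
        exact ⟨⟨hp.1, hp.2.1, hp.2.2.1⟩, hp.2.2.2⟩
      calc _ ≤ ((F.filter fun p => Disjoint p.2.support.toFinset U).card : ℝ) := by
            exact_mod_cast Finset.card_le_card h3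
        _ ≤ _ := hFU
        _ ≤ _ := by
            push_cast
            gcongr
    · calc _ ≤ ∑ v ∈ Xᶜ, ((d + μ ^ 2 / w) ^ (2 * s) * w ^ d) := Finset.sum_le_sum fun v hv =>
            (hX v hv).card_closed_walks_small_support_le hpos hd hw
        _ ≤ _ := by
            have hw0 : 0 < w := by linarith
            rw [Finset.sum_const, nsmul_eq_mul]
            gcongr
  have htrace := eigenvalueMultiplicity_mul_pow_le_sum (G := G.restrictTo (U ∪ X)ᶜ) μ
    (even_two_mul s)
  calc _ ≤ ((t + D ^ (2 * s + 2)) + ((G.restrictTo (U ∪ X)ᶜ).eigenvalueMultiplicity μ : ℝ)) *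
        μ ^ (2 * s) := by gcongr
    _ ≤ _ := by rw [add_mul]; linarith

end SimpleGraph

/-! ### Numerical inequalities for logarithms. -/

open Real in
-- Bernoulli's inequality for 16^(x/16). This makes m ≤ n sufficient when λ₂ ≤ 16.
theorem Real.div_four_le_logb_two_add_one {x : ℝ} (h0 : 0 ≤ x) (h16 : x ≤ 16) :
    x / 4 ≤ logb 2 (x + 1) := by
  rw [le_logb_iff_rpow_le one_lt_two (by linarith)]
  calc (2 : ℝ) ^ (x / 4) = (1 + 15 : ℝ) ^ (x / 16) := by
        rw [show (1 + 15 : ℝ) = 2 ^ (4 : ℝ) by norm_num, ← rpow_mul zero_le_two]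
        congr 1
        ring
    _ ≤ 1 + x / 16 * 15 :=
        rpow_one_add_le_one_add_mul_self (by norm_num) (by positivity) (by linarith)
    _ ≤ x + 1 := by linarith

open Real in
theorem Real.le_four_mul_logb_two_sq {x : ℝ} (h2 : 2 ≤ x) (h128 : x ≤ 128) :
    x ≤ 4 * logb 2 x ^ 2 := by
  -- On a dyadic interval the endpoints suffice; `hi` holds for 1 ≤ i ≤ 6 and fails at 7, hence the
  -- cutoff 128.
  have key (i : ℕ) (hi : (2 : ℝ) ^ (i + 1) ≤ 4 * i ^ 2) (hl : 2 ^ i ≤ x) (hr : x ≤ 2 ^ (i + 1)) :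
      x ≤ 4 * logb 2 x ^ 2 := by
    have : (i : ℝ) ≤ logb 2 x := by
      rw [le_logb_iff_rpow_le one_lt_two (by linarith), rpow_natCast]
      exact hl
    exact hr.trans (hi.trans (by gcongr))
  rcases le_total x 4 with h | h4
  · exact key 1 (by norm_num) (by linarith) (by norm_num; linarith)
  rcases le_total x 8 with h | h8
  · exact key 2 (by norm_num) (by linarith) (by norm_num; linarith)
  rcases le_total x 16 with h | h16
  · exact key 3 (by norm_num) (by linarith) (by norm_num; linarith)
  rcases le_total x 32 with h | h32
  · exact key 4 (by norm_num) (by linarith) (by norm_num; linarith)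
  rcases le_total x 64 with h | h64
  · exact key 5 (by norm_num) (by linarith) (by norm_num; linarith)
  · exact key 6 (by norm_num) (by linarith) (by norm_num; linarith)

open Real in
theorem Real.logb_two_le_div_sixteen {x : ℝ} (h : 128 ≤ x) : logb 2 x ≤ x / 16 := by
  have h2 := log_two_gt_d9
  have h3 := log_le_sub_one_of_pos (show 0 < x / 128 by linarith)
  have h4 : log (x / 128) = log x - 7 * log 2 := by
    rw [log_div (by linarith) (by norm_num), show (128 : ℝ) = 2 ^ 7 by norm_num, log_pow]
    norm_num
  rw [logb, div_le_iff₀ (by linarith)]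
  nlinarith

/-! ### Choice of parameters. -/

namespace SimpleGraph

variable {V : Type*} [Fintype V] [DecidableEq V] {G : SimpleGraph V} [DecidableRel G.Adj]

theorem eigenvalueMultiplicity_le_card (μ : ℝ) : G.eigenvalueMultiplicity μ ≤ Fintype.card V :=
  (Submodule.finrank_le _).trans (by simp)

/-- The bound on closed walks with small support, compared with the main term. -/
theorem small_support_bound_le {μ ν a : ℝ} {d l : ℕ} (hν : 16 ≤ ν) (hνμ : ν ≤ μ)
    (ha : ν = 2 ^ a) (ha4 : 4 ≤ a) (hd : (d : ℝ) ≤ ν / 4) (hl : (ν - 2) * a ≤ l) :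
    (d + μ ^ 2 / (4 * μ ^ 2 / ν)) ^ l * (4 * μ ^ 2 / ν) ^ d ≤ μ ^ l * (1 / ν) := by
  have hν0 : 0 < ν := by linarith
  have hμ0 : 0 < μ := by linarith
  have h1 : μ ^ 2 / (4 * μ ^ 2 / ν) = ν / 4 := by field_simp
  have hdl : 2 * d ≤ l := by
    have : (2 * d : ℝ) ≤ l := by nlinarith
    exact_mod_cast this
  -- The base is at most ν/2, half of the ν available; the saving 2^(-l) pays for (4ν)^d and for the
  -- extra factor ν.
  have h2 : (4 * ν) ^ d * ν ≤ 2 ^ l := by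
    have h4 : 4 * ν = 2 ^ (2 + a) := by
      rw [Real.rpow_add two_pos, ← ha]; norm_num
    have hexp : (4 * ν) ^ d * ν = 2 ^ ((2 + a) * d + a) := by
      rw [Real.rpow_add two_pos, ← ha, Real.rpow_mul zero_le_two, ← h4, Real.rpow_natCast]
    rw [hexp, ← Real.rpow_natCast 2 l]
    refine Real.rpow_le_rpow_of_exponent_le one_le_two (le_trans ?_ hl)
    have : (2 + a) * d ≤ (3 / 2 * a) * (ν / 4) := by gcongr; linarith
    nlinarith
  have hr : 1 ≤ μ / ν := (one_le_div hν0).2 hνμ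
  calc (d + μ ^ 2 / (4 * μ ^ 2 / ν)) ^ l * (4 * μ ^ 2 / ν) ^ d
      ≤ (ν / 2) ^ l * (4 * μ ^ 2 / ν) ^ d := by
        rw [h1]
        gcongr
        linarith
    _ = ν ^ l / 2 ^ l * (4 * ν) ^ d * (μ / ν) ^ (2 * d) := by
        rw [div_pow, mul_assoc, pow_mul, ← mul_pow]
        congr 2
        field_simp
    _ ≤ ν ^ l / 2 ^ l * (4 * ν) ^ d * (μ / ν) ^ l := by gcongr
    _ = μ ^ l * ((4 * ν) ^ d / 2 ^ l) := by
        rw [div_pow]; field_simp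
    _ ≤ μ ^ l * (1 / ν) := by
        refine mul_le_mul_of_nonneg_left ?_ (by positivity)
        rw [div_le_div_iff₀ (by positivity) hν0]
        linarith

/-- Allowing ν below μ lets one estimate serve both regimes. In units of n/ν, `t` costs at most 3a +
1 and the exceptional centres and the two walk counts cost 1 each; 3a + 4 ≤ 4a because a = log ν ≥
4. -/
theorem Connected.eigenvalueMultiplicity_secondEigenvalue_le (hG : G.Connected) {μ : ℝ}
    (hμ : μ = G.secondEigenvalue) {Δ : ℝ} (hΔ : (G.maxDegree : ℝ) ≤ Δ) (hdeg : 2 ≤ G.maxDegree)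
    {ν : ℝ} (hν : 16 ≤ ν) (hνμ : ν ≤ μ)
    (hL : ν * Real.logb 2 ν ≤ Real.logb Δ (Fintype.card V)) :
    (G.eigenvalueMultiplicity μ : ℝ) ≤ 4 * Fintype.card V * Real.logb 2 ν / ν := by
  have hν0 : 0 < ν := by linarith
  have hμ0 : 0 < μ := by linarith
  have hΔ2 : 2 ≤ Δ := le_trans (by exact_mod_cast hdeg) hΔ
  have : Nonempty V := hG.nonempty
  set n : ℝ := (Fintype.card V : ℝ) with hn
  have hn0 : 0 < n := Nat.cast_pos.2 Fintype.card_pos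
  set a := Real.logb 2 ν with ha
  set L := Real.logb Δ n
  have ha4 : 4 ≤ a := by
    rw [ha, Real.le_logb_iff_rpow_le one_lt_two hν0]
    norm_num
    exact hν
  have hνa : ν = 2 ^ a := (Real.rpow_logb two_pos (by norm_num) hν0).symm
  have hLpow : Δ ^ L = n := Real.rpow_logb (by linarith) (by linarith) hn0
  -- The largest `s` with 2s + 2 + a ≤ L, so that Δ^(2s+2) ≤ n/ν.
  set s := ⌊(L - a - 2) / 2⌋₊ with hs
  have h16a : 16 * a ≤ ν * a := by gcongr
  have hs_le : (s : ℝ) ≤ (L - a - 2) / 2 := Nat.floor_le (by linarith)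
  have hs_lt : (L - a - 2) / 2 < s + 1 := Nat.lt_floor_add_one _
  have hl : (ν - 2) * a ≤ (2 * s : ℕ) := by push_cast; linarith
  have hs1 : 1 ≤ s := by
    have : (0 : ℝ) < s := by linarith
    exact_mod_cast this
  set d := ⌊ν / 4⌋₊
  have hd_le : (d : ℝ) ≤ ν / 4 := Nat.floor_le (by linarith)
  have hd_lt : ν / 4 < d + 1 := Nat.lt_floor_add_one _
  have hd1 : 1 ≤ d := by
    have : (0 : ℝ) < d := by linarith
    exact_mod_cast this
  -- With d + 1 > ν/4 the exponent (d+1)t/n is at least 3a/4, which exceeds ln ν = a ln 2.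
  set t := ⌈3 * n * a / ν⌉₊
  have ht_le : 3 * n * a / ν ≤ t := Nat.le_ceil _
  have ht_lt : (t : ℝ) < 3 * n * a / ν + 1 := Nat.ceil_lt_add_one (by positivity)
  have hball : Δ ^ (2 * s + 2) * ν ≤ n := by
    calc Δ ^ (2 * s + 2) * ν ≤ Δ ^ (2 * s + 2) * Δ ^ a := by
          gcongr
          rw [hνa]
          exact Real.rpow_le_rpow zero_le_two hΔ2 (by linarith)
      _ = Δ ^ (2 * s + 2 + a) := by
          rw [Real.rpow_add (by linarith), ← Real.rpow_natCast]
          push_cast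
          rfl
      _ ≤ Δ ^ L := Real.rpow_le_rpow_of_exponent_le (by linarith) (by linarith)
      _ = n := hLpow
  have hball' : (G.maxDegree : ℝ) ^ (2 * s + 2) ≤ n / ν := by
    rw [le_div_iff₀ hν0]
    refine le_trans ?_ hball
    gcongr
  have hone : 1 ≤ n / ν := by
    rw [le_div_iff₀ hν0]
    refine le_trans ?_ hball
    gcongr
    exact one_le_pow₀ (by linarith)
  have hexp : Real.exp (-((d + 1) * t / n)) ≤ 1 / ν := by
    rw [one_div, ← Real.exp_log (inv_pos.2 hν0), Real.log_inv]
    refine Real.exp_le_exp.2 (neg_le_neg ?_)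
    have h1 : 3 / 4 * a ≤ (d + 1) * t / n := by
      rw [le_div_iff₀ hn0]
      calc 3 / 4 * a * n = ν / 4 * (3 * n * a / ν) := by field_simp
        _ ≤ (d + 1) * t := by gcongr
    refine le_trans ?_ h1
    have h2 := Real.log_two_lt_d9
    have h3 : Real.log ν = a * Real.log 2 := by
      rw [ha, Real.logb, div_mul_cancel₀ _ (Real.log_pos one_lt_two).ne']
    rw [h3]
    nlinarith
  have hw : 1 ≤ 4 * μ ^ 2 / ν := by
    rw [one_le_div hν0]
    nlinarith
  have hcore := hG.eigenvalueMultiplicity_secondEigenvalue_mul_pow_le hμ hμ0 le_rfl hdeg hs1 hd1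
    t hw
  rw [← hn] at hcore
  have hsmall := small_support_bound_le hν hνμ hνa ha4 hd_le hl
  have hpow : 0 < μ ^ (2 * s) := by positivity
  have hmain : (G.eigenvalueMultiplicity μ : ℝ) * μ ^ (2 * s) ≤
      (3 * n * a / ν + 4 * (n / ν)) * μ ^ (2 * s) := by
    calc _ ≤ _ := hcore
      _ ≤ (3 * n * a / ν + 1 + n / ν) * μ ^ (2 * s) + n * μ ^ (2 * s) * (1 / ν) +
          n * (μ ^ (2 * s) * (1 / ν)) := by gcongr
      _ = (3 * n * a / ν + 1 + 3 * (n / ν)) * μ ^ (2 * s) := by ring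
      _ ≤ _ := mul_le_mul_of_nonneg_right (by linarith) hpow.le
  refine (le_of_mul_le_mul_right hmain hpow).trans ?_
  have h1 : 3 * n * a / ν = 3 * a * (n / ν) := by ring
  have h2 : 4 * n * a / ν = 4 * a * (n / ν) := by ring
  rw [h1, h2]
  nlinarith [div_pos hn0 hν0]

end SimpleGraph

/-! ### The two regimes. -/

theorem theorem2p5 {V : Type*} [Fintype V] [DecidableEq V]
    (G : SimpleGraph V) [DecidableRel G.Adj] (hconn : G.Connected)
    (n : ℕ) (hn : Fintype.card V = n)
    (lam : ℝ) (hlam : lam = G.secondEigenvalue) (hpos : 0 < lam)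
    (Δ : ℝ) (hΔ : (G.maxDegree : ℝ) ≤ Δ) (hdeg : 2 ≤ G.maxDegree) :
    (lam * Real.logb 2 lam ≥ Real.logb Δ n → Real.logb Δ n > 2 →
      (G.eigenvalueMultiplicity lam : ℝ)
        ≤ 4 * n * (Real.logb 2 (Real.logb Δ n)) ^ 2 / Real.logb Δ n) ∧
    (lam * Real.logb 2 lam ≤ Real.logb Δ n →
      (G.eigenvalueMultiplicity lam : ℝ) ≤ 4 * n * Real.logb 2 (lam + 1) / lam) := by
  have htriv : (G.eigenvalueMultiplicity lam : ℝ) ≤ n := by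
    rw [← hn]
    exact_mod_cast G.eigenvalueMultiplicity_le_card lam
  have hn0 : (0 : ℝ) ≤ n := n.cast_nonneg
  refine ⟨fun h1 h2 => ?_, fun h => ?_⟩
  · set L := Real.logb Δ n
    have hL0 : 0 < L := by linarith
    rcases le_total L 128 with hL | hL
    · refine htriv.trans ?_
      rw [le_div_iff₀ hL0, mul_comm (4 : ℝ), mul_assoc]
      exact mul_le_mul_of_nonneg_left (Real.le_four_mul_logb_two_sq h2.le hL) hn0
    · set b := Real.logb 2 L with hb
      have hb7 : 7 ≤ b := by
        rw [hb, Real.le_logb_iff_rpow_le one_lt_two hL0]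
        norm_num
        exact hL
      have hb0 : 0 < b := by linarith
      have hν16 : 16 ≤ L / b := by
        rw [le_div_iff₀ hb0]
        linarith [Real.logb_two_le_div_sixteen hL]
      have hν0 : 0 < L / b := by linarith
      have hlogν : Real.logb 2 (L / b) ≤ b := by
        refine (Real.logb_le_logb_of_le one_lt_two hν0 ?_)
        exact div_le_self hL0.le (by linarith)
      have hνL : L / b * Real.logb 2 (L / b) ≤ L := by
        calc L / b * Real.logb 2 (L / b) ≤ L / b * b := by gcongr
          _ = L := div_mul_cancel₀ _ hb0.ne'
      -- Here ν = L/b. If λ₂ were smaller, monotonicity of x log x would give λ₂ log λ₂ < L, against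
      -- `h1`.
      have hνlam : L / b ≤ lam := by
        by_contra! hlt
        have hlog : Real.logb 2 lam < Real.logb 2 (L / b) :=
          Real.logb_lt_logb one_lt_two hpos hlt
        have hlogpos : 0 < Real.logb 2 (L / b) := Real.logb_pos one_lt_two (by linarith)
        have : lam * Real.logb 2 lam < L / b * Real.logb 2 (L / b) :=
          calc lam * Real.logb 2 lam < lam * Real.logb 2 (L / b) := by gcongr
            _ < _ := by gcongr
        linarith
      refine (hconn.eigenvalueMultiplicity_secondEigenvalue_le hlam hΔ hdeg hν16 hνlam
        (by rw [hn]; exact hνL)).trans ?_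
      rw [hn]
      calc 4 * n * Real.logb 2 (L / b) / (L / b) ≤ 4 * n * b / (L / b) := by gcongr
        _ = 4 * n * b ^ 2 / L := by field_simp
  · rcases le_total lam 16 with h16 | h16
    · refine htriv.trans ?_
      rw [le_div_iff₀ hpos]
      have := Real.div_four_le_logb_two_add_one hpos.le h16
      nlinarith
    · refine (hconn.eigenvalueMultiplicity_secondEigenvalue_le hlam hΔ hdeg h16 le_rfl
        (by rw [hn]; exact h)).trans ?_
      rw [hn]
      gcongr
      · exact one_lt_two
      · linarith
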